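/- Let $\mathbf k$ be a field, let $r_1,\dots,r_n$ be positive integers, let $E=E_1\oplus\cdots\oplus E_n$ with $\dim E_\alpha=r_\alpha$, and fix $d$ with $1\le d\le r_1+\cdots+r_n$. Choose a basis of $E$ made of bases of $E_1,\dots,E_n$, in this order, and let $\mathbb I$ be the set of $d$-element subsets $u$ of this basis; they index the Plücker coordinates $z_u$ on $\mathbb P(\wedge^d E)$. Let $\mathbb J$ be the set of weakly increasing strings $\mathbf a=a_1\cdots a_d$ over $\{1,\dots,n\}$ with at most $r_\alpha$ occurrences of each letter $\alpha$. Let $\mathfrak i(\mathbf a)=(i_1,\dots,i_n)$, where $i_\alpha$ is the number of occurrences of $\alpha$ in $\mathbf a$, and let $\mathbb I_{\mathfrak i(\mathbf a)}\subset\mathbb I$ be the set of those $u$ that contain exactly $i_\alpha$ basis vectors of $E_\alpha$ for every $\alpha$. The sets $\mathbb I_{\mathfrak i(\mathbf a)}$ are non-empty and partition $\mathbb I$. For $\mathbf a,\mathbf b\in\mathbb J$ put $\mathbf a\vee\mathbf b=a_1b_1a_2b_2\cdots a_db_d$, and let $\mathrm{sort}$ denote the operator that sorts a string into weakly increasing order.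 For $\mathbf p=[p_u]_{u\in\mathbb I}\in\mathbb P(\wedge^dE)$ with all $p_u\in\mathbf k$ nonzero, let $I_{\mathbf p}\subset\mathbf k[z_u]_{u\in\mathbb I}$ be the kernel of $$\mathbf k[z_u]_{u\in\mathbb I}\to\mathbf k[x_{\mathbf a}]_{\mathbf a\in\mathbb J}/I_\bullet,\qquad z_u\mapsto p_u x_{\mathbf a}\ \text{ for } u\in\mathbb I_{\mathfrak i(\mathbf a)},$$ where $I_\bullet$ is the kernel of $\mathbf k[x_{\mathbf a}]\to\mathbf k[t_1^{\pm1},\dots,t_n^{\pm1}]$, $x_{\mathbf a}\mapsto t_1^{i_1}\cdots t_n^{i_n}$ with $\mathfrak i(\mathbf a)=(i_1,\dots,i_n)$. For every $\mathbf a\in\mathbb J$ let $\prec_{\mathbf a}$ be any term order on $\mathbf k[z_u]_{u\in\mathbb I_{\mathfrak i(\mathbf a)}}$, and let $u_{\mathbf a}\in\mathbb I_{\mathfrak i(\mathbf a)}$ be the index of its smallest variable. **Theorem.** There is a term order $\prec_{\mathbf z}$ on $\mathbf k[z_u]_{u\in\mathbb I}$, which for every $\mathbf a$ agrees with $\prec_{\mathbf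 a}$ on monomials of equal degree in the variables $z_u$, $u\in\mathbb I_{\mathfrak i(\mathbf a)}$, such that for every point $\mathbf p$ as above (so that $\prec_{\mathbf z}$ does not depend on $\mathbf p$) the following hold. 1. $I_{\mathbf p}$ is the ideal of the closure of the torus orbit of $\mathbf p$: it consists of the polynomials over $\mathbf k$ that vanish on the affine cone over the orbit of $\mathbf p$ under $\mathbb G_m^n$, over the algebraic closure of $\mathbf k$, where the $\alpha$-th factor $\mathbb G_m$ acts on $E$ by scaling $E_\alpha$. 2. The set $\mathfrak G_{\mathbf p}$ of all nonzero binomials of the forms $$p_{u_{\mathbf a}}z_u-p_uz_{u_{\mathbf a}}\quad(\mathbf a\in\mathbb J,\ u\in\mathbb I_{\mathfrak i(\mathbf a)}),$$ $$p_{u_{\mathbf k_o}}p_{u_{\mathbf k_e}}z_{u_{\mathbf a}}z_{u_{\mathbf b}}-p_{u_{\mathbf a}}p_{u_{\mathbf b}}z_{u_{\mathbf k_o}}z_{u_{\mathbf k_e}}\quad(\mathbf a,\mathbf b,\mathbf k_o,\mathbf k_e\in\mathbb J,\ \mathrm{sort}(\mathbf a\vee\mathbf b)=\mathbf k_o\vee\mathbf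 k_e)$$ is a reduced Gröbner basis of $I_{\mathbf p}$ with respect to $\prec_{\mathbf z}$, with leading terms $p_{u_{\mathbf a}}z_u$ and $p_{u_{\mathbf k_o}}p_{u_{\mathbf k_e}}z_{u_{\mathbf a}}z_{u_{\mathbf b}}$, respectively. 3. Dividing the linear binomials by $p_{u_{\mathbf a}}$ and the quadratic ones by $p_{u_{\mathbf k_o}}p_{u_{\mathbf k_e}}$ yields the unique reduced Gröbner basis of $I_{\mathbf p}$ with respect to $\prec_{\mathbf z}$ all of whose leading coefficients are $1$. Here a Gröbner basis of an ideal $I$ is a finite set of nonzero elements of $I$ whose initial monomials generate the initial ideal of $I$; it is called reduced if, for any two distinct elements $g,g'$ of it, no term of $g'$ is divisible by the initial monomial of $g$. -/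

import Mathlib

/-! ## Gröbner bases

A term order on the monomials in finitely many variables is Mathlib's `MonomialOrder`;
`m.degree f` is the exponent of the initial monomial of `f ≠ 0`. -/

namespace PolyDiag

open MvPolynomial

/-- The initial ideal of `I`, generated by the initial monomials of the nonzero elements of `I`. -/
noncomputable def initialIdeal {σ k : Type*} [Field k] (m : MonomialOrder σ) (I : Ideal (MvPolynomial σ k)) :
    Ideal (MvPolynomial σ k) :=
  Ideal.span {q | ∃ f ∈ I, f ≠ 0 ∧ q = monomial (m.degree f) 1}

/-- A finite subset `G` of `I` is a Gröbner basis of `I` if the initial monomials of its (nonzero)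
elements generate the initial ideal. -/
def IsGroebnerBasis {σ k : Type*} [Field k] (m : MonomialOrder σ) (G : Set (MvPolynomial σ k))
    (I : Ideal (MvPolynomial σ k)) : Prop :=
  G.Finite ∧ G ⊆ (I : Set (MvPolynomial σ k)) ∧ 0 ∉ G ∧
    Ideal.span {q | ∃ g ∈ G, q = monomial (m.degree g) 1} = initialIdeal m I

/-- A Gröbner basis is reduced if for distinct `g, g'` in it no term of `g'` is divisible by the
initial monomial of `g`. -/
def IsReducedGroebnerBasis {σ k : Type*} [Field k] (m : MonomialOrder σ)
    (G : Set (MvPolynomial σ k)) (I : Ideal (MvPolynomial σ k)) : Prop :=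
  IsGroebnerBasis m G I ∧
    ∀ g ∈ G, ∀ g' ∈ G, g ≠ g' → ∀ s ∈ g'.support, ¬ m.degree g ≤ s

/-! ## Strings and Plücker indices -/

/-- The number of occurrences of each letter in a string of length `d` over `Fin n`. -/
def content {n d : ℕ} (a : Fin d → Fin n) (α : Fin n) : ℕ :=
  (Finset.univ.filter fun j => a j = α).card

/-- Weakly increasing strings of length `d` over `Fin n` having at most `r α` occurrences of the
letter `α`. -/
abbrev Str {n : ℕ} (r : Fin n → ℕ) (d : ℕ) : Type :=
  {a : Fin d → Fin n // Monotone a ∧ ∀ α, content a α ≤ r α}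

/-- The Plücker indices: `d`-element subsets of the standard basis of `E = ⊕ E_α`, `dim E_α = r α`.
The basis is indexed by the pairs `(α, j)` with `j < r α`, listed block after block; an increasing
sequence `u_1 < ⋯ < u_d` is identified with the set of its entries. -/
abbrev Pl {n : ℕ} (r : Fin n → ℕ) (d : ℕ) : Type :=
  {u : Finset (Σ α : Fin n, Fin (r α)) // u.card = d}

/-- The number of elements of `u` in each block. -/
def blockCount {n d : ℕ} {r : Fin n → ℕ} (u : Pl r d) (α : Fin n) : ℕ :=
  (u.1.filter fun x => x.1 = α).card

/-- The Plücker indices of the type given by the string `a`: the basis vectors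
`e_{u_1} ∧ ⋯ ∧ e_{u_d}` of `⋀^{i_1} E_1 ⊗ ⋯ ⊗ ⋀^{i_n} E_n`, where `i_α` is the number of
occurrences of `α` in `a`. -/
def block {n d : ℕ} {r : Fin n → ℕ} (a : Str r d) : Set (Pl r d) :=
  {u | ∀ α, blockCount u α = content a.1 α}

/-- The list of blocks met by `u`, with multiplicity, in weakly increasing order. -/
def letters {n d : ℕ} {r : Fin n → ℕ} (u : Pl r d) : List (Fin n) :=
  (u.1.val.map Sigma.fst).sort (· ≤ ·)

theorem length_letters {n d : ℕ} {r : Fin n → ℕ} (u : Pl r d) : (letters u).length = d := by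
  simpa [letters] using u.2

theorem count_letters {n d : ℕ} {r : Fin n → ℕ} (u : Pl r d) (α : Fin n) :
    (letters u).count α = blockCount u α := by
  rw [← Multiset.coe_count, letters, Multiset.sort_eq, Multiset.count_map, blockCount,
    Finset.card_def, Finset.filter_val]
  congr 1
  exact Multiset.filter_congr fun x _ => eq_comm

theorem content_get {n d : ℕ} (l : List (Fin n)) (h : l.length = d) (α : Fin n) :
    content (fun j : Fin d => l.get (j.cast h.symm)) α = l.count α := by
  subst h
  simp only [content, Fin.cast_refl, id_eq]
  exact (Fin.card_filter_univ_eq_vector_get_eq_count α ⟨l, rfl⟩)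

theorem blockCount_le {n d : ℕ} {r : Fin n → ℕ} (u : Pl r d) (α : Fin n) :
    blockCount u α ≤ r α := by
  have h : (u.1.filter fun x => x.1 = α) ⊆
      (Finset.univ : Finset (Fin (r α))).map ⟨Sigma.mk α, sigma_mk_injective⟩ := by
    rintro ⟨β, j⟩ hx
    obtain rfl : β = α := (Finset.mem_filter.1 hx).2
    simp
  simpa [blockCount] using Finset.card_le_card h

/-- The string `a` with `u ∈ block a`. -/
def word {n d : ℕ} {r : Fin n → ℕ} (u : Pl r d) : Str r d :=
  ⟨fun j => (letters u).get (j.cast (length_letters u).symm), by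
    refine ⟨?_, fun α => ?_⟩
    · intro i j hij
      have h : (letters u).SortedLE := (Multiset.pairwise_sort _ _).sortedLE
      exact h.monotone_get hij
    · rw [content_get _ (length_letters u), count_letters]
      exact blockCount_le u α⟩

theorem mem_block_word {n d : ℕ} {r : Fin n → ℕ} (u : Pl r d) : u ∈ block (word u) := fun α => by
  rw [word, content_get _ (length_letters u), count_letters]

theorem block_nonempty {n d : ℕ} {r : Fin n → ℕ} (a : Str r d) : (block a).Nonempty := by
  have hsum : ∑ α, content a.1 α = d := by
    simpa [content] using (Finset.card_eq_sum_card_fiberwise (s := Finset.univ)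
      (t := Finset.univ) (f := a.1) (by simp)).symm
  choose s hs using fun α => Finset.exists_subset_card_eq
    (s := (Finset.univ : Finset (Fin (r α)))) (n := content a.1 α) (by simpa using a.2.2 α)
  refine ⟨⟨Finset.univ.sigma s, ?_⟩, fun α => ?_⟩
  · rw [Finset.card_sigma, ← hsum]
    exact Finset.sum_congr rfl fun α _ => (hs α).2
  · rw [← (hs α).2, blockCount, ← Finset.card_map (s := s α)
      (Function.Embedding.sigmaMk (β := fun α => Fin (r α)) α)]
    congr 1
    ext ⟨β, j⟩
    simp only [Finset.mem_filter, Finset.mem_sigma, Finset.mem_map, Finset.mem_univ, true_and,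
      Function.Embedding.sigmaMk_apply]
    constructor
    · rintro ⟨h, rfl⟩
      exact ⟨j, h, rfl⟩
    · rintro ⟨i, h, e⟩
      cases e
      exact ⟨h, rfl⟩

instance {n d : ℕ} {r : Fin n → ℕ} (a : Str r d) : Nonempty (block a) :=
  (block_nonempty a).to_subtype

/-- The string `a_1 b_1 a_2 b_2 ⋯ a_d b_d`. -/
def interleave {n d : ℕ} {r : Fin n → ℕ} (a b : Str r d) : List (Fin n) :=
  (List.ofFn fun j => [a.1 j, b.1 j]).flatten

/-- `sort (a ∨ b) = o ∨ e`: the pair `(o, e)` is the sorting of the pair `(a, b)`. -/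
def SortsTo {n d : ℕ} {r : Fin n → ℕ} (a b o e : Str r d) : Prop :=
  (interleave a b).insertionSort (· ≤ ·) = interleave o e

/-! ## The toric ideals -/

noncomputable section

/-- `x_a ↦ t^{i(a)}`. The exponents are nonnegative, so that the Laurent polynomial ring in `t` may
be replaced by its subring of polynomials. -/
def rho (k : Type*) [Field k] {n : ℕ} (r : Fin n → ℕ) (d : ℕ) :
    MvPolynomial (Str r d) k →ₐ[k] MvPolynomial (Fin n) k :=
  aeval fun a => ∏ α, X α ^ content a.1 α

def toricIdeal (k : Type*) [Field k] {n : ℕ} (r : Fin n → ℕ) (d : ℕ) :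
    Ideal (MvPolynomial (Str r d) k) :=
  RingHom.ker (rho k r d)

/-- `z_u ↦ p_u x_a`, where `u` lies in the block of `a`. -/
def zeta {k : Type*} [Field k] {n d : ℕ} {r : Fin n → ℕ} (p : Pl r d → k) :
    MvPolynomial (Pl r d) k →ₐ[k] MvPolynomial (Str r d) k :=
  aeval fun u => C (p u) * X (word u)

/-- The ideal `I_p`, the kernel of `k[z] → k[x] → k[x] / I`, with `I` the toric ideal above. -/
def orbitIdeal {k : Type*} [Field k] {n d : ℕ} {r : Fin n → ℕ} (p : Pl r d → k) :
    Ideal (MvPolynomial (Pl r d) k) :=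
  RingHom.ker ((Ideal.Quotient.mkₐ k (toricIdeal k r d)).comp (zeta p))

/-- The affine cone (without its vertex) over the torus orbit of `[p]`, in coordinates in the
algebraic closure of `k`: `t ∈ 𝔾_m^n` multiplies the coordinate `u` by `∏ t_α ^ i_α`, where `i_α`
is the number of elements of `u` in the block `α`. -/
def orbitCone {k : Type*} [Field k] {n d : ℕ} {r : Fin n → ℕ} (p : Pl r d → k) :
    Set (Pl r d → AlgebraicClosure k) :=
  {z | ∃ (c : (AlgebraicClosure k)ˣ) (t : Fin n → (AlgebraicClosure k)ˣ), ∀ u,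
    z u = c * (∏ α, (t α : AlgebraicClosure k) ^ blockCount u α) *
      algebraMap k (AlgebraicClosure k) (p u)}

/-! ## The term orders and the binomials -/

/-- The index `u_a` of the smallest variable in the block of `a`, for given term orders on the
polynomial rings in the variables of the single blocks. -/
def blockMin {n d : ℕ} {r : Fin n → ℕ} (ord : ∀ a : Str r d, MonomialOrder (block a))
    (a : Str r d) : Pl r d :=
  (Function.argmin fun u : block a => (ord a).toSyn (Finsupp.single u 1)).1

/-- `m` agrees with the given term orders on monomials of equal degree in the variables of a single
block. -/
def ExtendsBlockOrders {n d : ℕ} {r : Fin n → ℕ} (ord : ∀ a : Str r d, MonomialOrder (block a))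
    (m : MonomialOrder (Pl r d)) : Prop :=
  ∀ (a : Str r d) (s t : block a →₀ ℕ), s.degree = t.degree →
    (m.toSyn (s.mapDomain Subtype.val) < m.toSyn (t.mapDomain Subtype.val) ↔
      (ord a).toSyn s < (ord a).toSyn t)

/-- `p_{u_a} z_u - p_u z_{u_a}` -/
def linBinomial {k : Type*} [Field k] {n d : ℕ} {r : Fin n → ℕ}
    (ord : ∀ a : Str r d, MonomialOrder (block a)) (p : Pl r d → k) (a : Str r d) (u : Pl r d) :
    MvPolynomial (Pl r d) k :=
  C (p (blockMin ord a)) * X u - C (p u) * X (blockMin ord a)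

/-- `p_{u_o} p_{u_e} z_{u_a} z_{u_b} - p_{u_a} p_{u_b} z_{u_o} z_{u_e}` -/
def quadBinomial {k : Type*} [Field k] {n d : ℕ} {r : Fin n → ℕ}
    (ord : ∀ a : Str r d, MonomialOrder (block a)) (p : Pl r d → k) (a b o e : Str r d) :
    MvPolynomial (Pl r d) k :=
  C (p (blockMin ord o) * p (blockMin ord e)) * X (blockMin ord a) * X (blockMin ord b) -
    C (p (blockMin ord a) * p (blockMin ord b)) * X (blockMin ord o) * X (blockMin ord e)

/-- The nonzero linear binomials `p_{u_a} z_u - p_u z_{u_a}` with `u` in the block of `a`, and the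
nonzero quadratic binomials
`p_{u_o} p_{u_e} z_{u_a} z_{u_b} - p_{u_a} p_{u_b} z_{u_o} z_{u_e}` with `sort (a ∨ b) = o ∨ e`. -/
def groebnerSet {k : Type*} [Field k] {n d : ℕ} {r : Fin n → ℕ}
    (ord : ∀ a : Str r d, MonomialOrder (block a)) (p : Pl r d → k) :
    Set (MvPolynomial (Pl r d) k) :=
  ({f | ∃ a, ∃ u ∈ block a, f = linBinomial ord p a u} ∪
    {f | ∃ a b o e, SortsTo a b o e ∧ f = quadBinomial ord p a b o e}) \ {0}

/-- The same binomials, divided by `p_{u_a}` and by `p_{u_o} p_{u_e}` respectively. -/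
def monicGroebnerSet {k : Type*} [Field k] {n d : ℕ} {r : Fin n → ℕ}
    (ord : ∀ a : Str r d, MonomialOrder (block a)) (p : Pl r d → k) :
    Set (MvPolynomial (Pl r d) k) :=
  ({f | ∃ a, ∃ u ∈ block a, f = C (p (blockMin ord a))⁻¹ * linBinomial ord p a u} ∪
    {f | ∃ a b o e, SortsTo a b o e ∧
      f = C (p (blockMin ord o) * p (blockMin ord e))⁻¹ * quadBinomial ord p a b o e}) \ {0}

end

end PolyDiag

open PolyDiag MvPolynomial

universe w

/-!
The orbit ideal `I_p` is the kernel of `z_u ↦ p_u t^{i(u)}`. It is homogeneous for the multidegree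
given by the exponents of `t`, and no element of it has a single term in some multidegree
(`exists_ne_torusDegree_eq`); hence its initial monomials are exactly the monomials that are not the
smallest ones of their multidegree, for every term order.

The term order compares the total weight of the strings of the variables first, and breaks ties
block by block with the given orders (`plOrder`). The weight of a string is the sum of the squares of
the numbers of letters in all intervals of the alphabet. As sorting a pair of strings makes these
numbers as equal as possible while keeping their sums, and a pair for which they all differ by at most
one is already sorted, the weight drops under every nontrivial sorting (`SortsTo.stringWeight_lt`).
So the initial monomials of the binomials are the `z_u` with `u` not the smallest of its block
and the `z_{u_a} z_{u_b}` with `a, b` not sorted.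

A monomial divisible by none of these is a product of variables `z_{u_a}` with pairwise sorted strings
`a`. The partial counts `#{j | a_j < i}` of such strings form a chain in which any two differ
by at most one, so that the largest is the average, rounded up, and the monomial is determined by its
multidegree (`eq_of_sorted_of_sum_eq`, `standard_unique`). The smallest monomial of a multidegree is
of this kind, hence it is the only one, and every other monomial of the multidegree is divisible by
the initial monomial of a binomial (`exists_degree_le_of_lt`). This is the Gröbner basis property.
Reducedness is read off from the exponents, and uniqueness holds for monic reduced Gröbner bases of
any ideal (`IsReducedGroebnerBasis.eq_of_monic`).

That `I_p` is the vanishing ideal of the orbit cone holds since a polynomial vanishing on a torus over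
an infinite field is zero; the additional scalar of the cone is absorbed into the torus, all
coordinates having the same degree `d ≥ 1` in `t` (`orbitIdeal_eq_vanishingIdeal`).
-/

namespace PolyDiag

/-! ### Term orders from injective maps to ordered monoids -/

section TermOrders

variable {σ : Type*}

/-- The term order on `σ` obtained by pulling back the order of a well-ordered monoid `M` along an
injective homomorphism with nonnegative values. Its order lives on the exponents themselves, so that
it is in the universe of `σ` whatever the universe of `M`. -/
noncomputable def termOrderOfInjective {M : Type*} [AddCommMonoid M] [LinearOrder M]
    [IsOrderedCancelAddMonoid M] [WellFoundedLT M] (φ : (σ →₀ ℕ) →+ M)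
    (hφ : Function.Injective φ) (hpos : ∀ s, 0 ≤ φ s) : MonomialOrder σ :=
  letI lo : LinearOrder (Lex (σ →₀ ℕ)) := LinearOrder.lift' (fun s => φ (ofLex s)) hφ
  { syn := Lex (σ →₀ ℕ)
    linearOrderSyn := lo
    isOrderedAddMonoid_syn :=
      { add_le_add_left := fun a b (h : φ (ofLex a) ≤ φ (ofLex b)) c => by
          change φ (ofLex a + ofLex c) ≤ φ (ofLex b + ofLex c)
          simpa only [map_add, add_le_add_iff_right] using h }
    toSyn := ⟨toLex, fun _ _ => rfl⟩
    toSyn_monotone := fun s t h => by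
      obtain ⟨c, rfl⟩ := exists_add_of_le h
      change φ s ≤ φ (s + c)
      simpa only [map_add, le_add_iff_nonneg_right] using hpos c
    wellFoundedLT_syn := ⟨InvImage.wf (fun s => φ (ofLex s)) wellFounded_lt⟩ }

theorem termOrderOfInjective_lt_iff {M : Type*} [AddCommMonoid M] [LinearOrder M]
    [IsOrderedCancelAddMonoid M] [WellFoundedLT M] (φ : (σ →₀ ℕ) →+ M)
    (hφ : Function.Injective φ) (hpos : ∀ s, 0 ≤ φ s) (s t : σ →₀ ℕ) :
    (termOrderOfInjective φ hφ hpos).toSyn s < (termOrderOfInjective φ hφ hpos).toSyn t ↔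
      φ s < φ t :=
  Iff.rfl

variable {N : ℕ} (B : Fin N → Set σ) (ω : σ → ℕ) (ord : ∀ i, MonomialOrder (B i))

/-- The map sending an exponent to its `ω`-weight, followed by its restrictions to the blocks, in the
lexicographic order. -/
noncomputable def weightBlockHom : (σ →₀ ℕ) →+ ℕ ×ₗ (Πₗ i, (ord i).syn) where
  toFun s := toLex (Finsupp.weight ω s,
    toLex fun i => (ord i).toSyn (s.subtypeDomain fun x => x ∈ B i))
  map_zero' := by
    simp only [map_zero, Finsupp.subtypeDomain_zero]
    rfl
  map_add' s t := by
    simp only [map_add, Finsupp.subtypeDomain_add]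
    rfl

theorem weightBlockHom_injective (hB : ∀ x, ∃ i, x ∈ B i) :
    Function.Injective (weightBlockHom B ω ord) := by
  intro s t h
  have h2 := congrArg (fun z => ofLex (ofLex z).2) h
  ext x
  obtain ⟨i, hi⟩ := hB x
  have h3 := (ord i).toSyn.injective (congrFun h2 i)
  exact DFunLike.congr_fun h3 ⟨x, hi⟩

theorem weightBlockHom_nonneg (s : σ →₀ ℕ) : 0 ≤ weightBlockHom B ω ord s := by
  refine Prod.Lex.toLex_mono (a := (0, toLex 0)) ⟨Nat.zero_le _, ?_⟩
  exact Pi.toLex_monotone fun i => (ord i).zero_le _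

/-- The term order comparing first the `ω`-weights and then, one after the other, the parts of the
monomials in the variables of the single blocks `B i`. -/
noncomputable def weightBlockOrder (hB : ∀ x, ∃ i, x ∈ B i) : MonomialOrder σ :=
  termOrderOfInjective (weightBlockHom B ω ord) (weightBlockHom_injective B ω ord hB)
    (weightBlockHom_nonneg B ω ord)

theorem weightBlockOrder_lt_of_weight_lt (hB : ∀ x, ∃ i, x ∈ B i) {s t : σ →₀ ℕ}
    (h : Finsupp.weight ω s < Finsupp.weight ω t) :
    (weightBlockOrder B ω ord hB).toSyn s < (weightBlockOrder B ω ord hB).toSyn t :=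
  (termOrderOfInjective_lt_iff _ _ _ _ _).2 (Prod.Lex.toLex_lt_toLex.2 (Or.inl h))

/-- On monomials of the same weight that agree outside the block `B i`, the order is the one given
on that block. -/
theorem weightBlockOrder_lt_iff (hB : ∀ x, ∃ i, x ∈ B i) {s t : σ →₀ ℕ} (i : Fin N)
    (h : Finsupp.weight ω s = Finsupp.weight ω t) (hst : ∀ j ≠ i, ∀ x ∈ B j, s x = t x) :
    (weightBlockOrder B ω ord hB).toSyn s < (weightBlockOrder B ω ord hB).toSyn t ↔
      (ord i).toSyn (s.subtypeDomain fun x => x ∈ B i) <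
        (ord i).toSyn (t.subtypeDomain fun x => x ∈ B i) := by
  have hj : ∀ j ≠ i, s.subtypeDomain (fun x => x ∈ B j) = t.subtypeDomain fun x => x ∈ B j :=
    fun j hj => Finsupp.ext fun x => hst j hj x x.2
  refine (termOrderOfInjective_lt_iff _ _ _ _ _).trans (Prod.Lex.toLex_lt_toLex.trans ?_)
  simp only [h, lt_irrefl, true_and, false_or]
  constructor
  · rintro ⟨j, -, hlt⟩
    by_cases hji : j = i
    · subst hji
      exact hlt
    · refine absurd (show (ord j).toSyn _ < (ord j).toSyn _ from hlt) ?_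
      rw [hj j hji]
      exact lt_irrefl _
  · intro hlt
    exact ⟨i, fun j hji => congrArg (ord j).toSyn (hj j hji.ne), hlt⟩

end TermOrders

/-! ### Gröbner bases and their uniqueness -/

section Groebner

variable {σ k : Type*} [Field k] {m : MonomialOrder σ} {I : Ideal (MvPolynomial σ k)}
  {G G' : Set (MvPolynomial σ k)}

theorem monomial_mem_span_iff {S : Set (MvPolynomial σ k)} {s : σ →₀ ℕ} :
    monomial s (1 : k) ∈ Ideal.span {q | ∃ g ∈ S, q = monomial (m.degree g) 1} ↔
      ∃ g ∈ S, m.degree g ≤ s := by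
  have h : {q : MvPolynomial σ k | ∃ g ∈ S, q = monomial (m.degree g) 1} =
      (fun t => monomial t (1 : k)) '' (m.degree '' S) := by
    ext q
    simp [eq_comm]
  classical
  rw [h, mem_ideal_span_monomial_image]
  simp [support_monomial]

/-- The division criterion for Gröbner bases. -/
theorem isGroebnerBasis_of_degree_le (hfin : G.Finite) (hGI : G ⊆ (I : Set (MvPolynomial σ k)))
    (h0 : 0 ∉ G) (h : ∀ f ∈ I, f ≠ 0 → ∃ g ∈ G, m.degree g ≤ m.degree f) :
    IsGroebnerBasis m G I := by
  refine ⟨hfin, hGI, h0, le_antisymm (Ideal.span_mono ?_) (Ideal.span_le.2 ?_)⟩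
  · rintro q ⟨g, hg, rfl⟩
    exact ⟨g, hGI hg, fun h => h0 (h ▸ hg), rfl⟩
  · rintro q ⟨f, hf, hf0, rfl⟩
    exact monomial_mem_span_iff.2 (h f hf hf0)

theorem IsGroebnerBasis.exists_degree_le (hG : IsGroebnerBasis m G I) {f : MvPolynomial σ k}
    (hf : f ∈ I) (hf0 : f ≠ 0) : ∃ g ∈ G, m.degree g ≤ m.degree f := by
  rw [← monomial_mem_span_iff (k := k), hG.2.2.2]
  exact Ideal.subset_span ⟨f, hf, hf0, rfl⟩

/-- In a reduced Gröbner basis an initial monomial dividing another one belongs to the same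
element. -/
theorem IsReducedGroebnerBasis.eq_of_degree_le (hG : IsReducedGroebnerBasis m G I)
    {g g' : MvPolynomial σ k} (hg : g ∈ G) (hg' : g' ∈ G) (h : m.degree g ≤ m.degree g') :
    g = g' := by
  by_contra hne
  exact hG.2 g hg g' hg' hne _ (m.degree_mem_support fun h0 => hG.1.2.2.1 (h0 ▸ hg')) h

/-- Two reduced Gröbner bases have the same initial monomials, since these are the minimal ones of
the initial ideal. -/
theorem IsReducedGroebnerBasis.exists_degree_eq (hG : IsReducedGroebnerBasis m G I)
    (hG' : IsReducedGroebnerBasis m G' I) {g : MvPolynomial σ k} (hg : g ∈ G) :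
    ∃ g' ∈ G', m.degree g' = m.degree g := by
  obtain ⟨g', hg', h1⟩ := hG'.1.exists_degree_le (hG.1.2.1 hg) fun h0 => hG.1.2.2.1 (h0 ▸ hg)
  obtain ⟨g'', hg'', h2⟩ :=
    hG.1.exists_degree_le (hG'.1.2.1 hg') fun h0 => hG'.1.2.2.1 (h0 ▸ hg')
  obtain rfl := hG.eq_of_degree_le hg'' hg (h2.trans h1)
  exact ⟨g', hg', le_antisymm h1 h2⟩

theorem IsReducedGroebnerBasis.notMem_support (hG : IsReducedGroebnerBasis m G I)
    {g g' : MvPolynomial σ k} (hg : g ∈ G) (hg' : g' ∈ G) {s : σ →₀ ℕ} (hgs : m.degree g ≤ s)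
    (hs : m.toSyn s < m.toSyn (m.degree g')) : s ∉ g'.support := by
  intro hmem
  refine hG.2 g hg g' hg' ?_ s hmem hgs
  rintro rfl
  exact hs.not_ge (m.toSyn_monotone hgs)

theorem IsReducedGroebnerBasis.subset_of_monic (hG : IsReducedGroebnerBasis m G I)
    (hG' : IsReducedGroebnerBasis m G' I) (hm : ∀ g ∈ G, m.Monic g) (hm' : ∀ g ∈ G', m.Monic g) :
    G ⊆ G' := by
  intro g hg
  obtain ⟨g', hg', hdeg⟩ := hG.exists_degree_eq hG' hg
  suffices h : g - g' = 0 by rwa [sub_eq_zero.1 h]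
  by_contra hne
  have hmem := m.degree_mem_support hne
  have hI : g - g' ∈ I := I.sub_mem (hG.1.2.1 hg) (hG'.1.2.1 hg')
  -- The initial terms of `g` and `g'` cancel, so the initial monomial of `g - g'` is smaller.
  have hlt : m.toSyn (m.degree (g - g')) < m.toSyn (m.degree g) := by
    refine lt_of_le_of_ne ?_ fun h => ?_
    · simpa only [hdeg, sup_idem] using m.degree_sub_le (f := g) (g := g')
    · rw [m.toSyn.injective h, mem_support_iff, coeff_sub, (hm g hg).coeff_degree, ← hdeg,
        (hm' g' hg').coeff_degree, sub_self] at hmem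
      exact hmem rfl
  obtain ⟨f, hf, hfle⟩ := hG.1.exists_degree_le hI hne
  obtain ⟨f', hf', hfdeg⟩ := hG.exists_degree_eq hG' hf
  have h1 := notMem_support_iff.1 (hG.notMem_support hf hg hfle hlt)
  have h2 := notMem_support_iff.1
    (hG'.notMem_support hf' hg' (hfdeg.le.trans hfle) (hlt.trans_eq (congrArg _ hdeg.symm)))
  rw [mem_support_iff, coeff_sub, h1, h2, sub_self] at hmem
  exact hmem rfl

theorem IsReducedGroebnerBasis.eq_of_monic (hG : IsReducedGroebnerBasis m G I)
    (hG' : IsReducedGroebnerBasis m G' I) (hm : ∀ g ∈ G, m.Monic g) (hm' : ∀ g ∈ G', m.Monic g) :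
    G = G' :=
  (hG.subset_of_monic hG' hm hm').antisymm (hG'.subset_of_monic hG hm' hm)

theorem degree_binomial {s t : σ →₀ ℕ} {c c' : k} (h : m.toSyn t < m.toSyn s) (hc : c ≠ 0) :
    m.degree (monomial s c - monomial t c') = s := by
  classical
  have hs : m.degree (monomial s c) = s := by rw [m.degree_monomial, if_neg hc]
  rw [m.degree_sub_of_lt, hs]
  rw [hs]
  exact (m.degree_monomial_le c').trans_lt h

theorem leadingCoeff_binomial {s t : σ →₀ ℕ} {c c' : k} (h : m.toSyn t < m.toSyn s)
    (hc : c ≠ 0) : m.leadingCoeff (monomial s c - monomial t c') = c := by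
  classical
  rw [m.leadingCoeff_sub_of_lt, m.leadingCoeff_monomial]
  rw [m.degree_monomial c, if_neg hc]
  exact (m.degree_monomial_le c').trans_lt h

theorem leadingTerm_binomial {s t : σ →₀ ℕ} {c c' : k} (h : m.toSyn t < m.toSyn s)
    (hc : c ≠ 0) : m.leadingTerm (monomial s c - monomial t c') = monomial s c := by
  rw [MonomialOrder.leadingTerm, degree_binomial h hc, leadingCoeff_binomial h hc]

theorem support_binomial_subset {s t x : σ →₀ ℕ} {c c' : k}
    (hx : x ∈ (monomial s c - monomial t c' : MvPolynomial σ k).support) : x = s ∨ x = t := by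
  classical
  rw [mem_support_iff, coeff_sub, coeff_monomial, coeff_monomial] at hx
  by_contra! h
  rw [if_neg h.1.symm, if_neg h.2.symm, sub_zero] at hx
  exact hx rfl

end Groebner

/-! ### Partial counts of strings -/

section Strings

variable {n d : ℕ}

/-- The number of letters smaller than `i` in a string, for `0 ≤ i ≤ n`. -/
def partialCount (a : Fin d → Fin n) (i : ℕ) : ℕ :=
  (Finset.univ.filter fun j => (a j : ℕ) < i).card

theorem partialCount_zero (a : Fin d → Fin n) : partialCount a 0 = 0 := by
  simp [partialCount]

theorem partialCount_length (a : Fin d → Fin n) : partialCount a n = d := by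
  simp [partialCount]

theorem partialCount_succ (a : Fin d → Fin n) (α : Fin n) :
    partialCount a (α + 1) = partialCount a α + content a α := by
  rw [partialCount, partialCount, content, ← Finset.card_union_of_disjoint]
  · congr 1
    ext j
    simp only [Finset.mem_filter, Finset.mem_union, Finset.mem_univ, true_and, Fin.ext_iff]
    omega
  · rw [Finset.disjoint_filter]
    rintro j - h rfl
    exact lt_irrefl _ h

theorem partialCount_eq_sum (a : Fin d → Fin n) (i : ℕ) :
    partialCount a i = ∑ α : Fin n, if (α : ℕ) < i then content a α else 0 := by
  rw [partialCount, Finset.card_eq_sum_card_fiberwise (f := a) (t := Finset.univ) (by simp)]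
  refine Finset.sum_congr rfl fun α _ => ?_
  rw [content, Finset.filter_filter]
  split_ifs with h
  · congr 1
    ext j
    simp only [Finset.mem_filter, Finset.mem_univ, true_and, and_iff_right_iff_imp]
    rintro rfl
    exact h
  · rw [Finset.card_eq_zero, Finset.filter_eq_empty_iff]
    rintro j - ⟨h1, rfl⟩
    exact h h1

theorem sum_content (a : Fin d → Fin n) : ∑ α, content a α = d := by
  have h := partialCount_eq_sum a n
  rw [partialCount_length] at h
  simpa using h.symm

theorem content_eq_count (a : Fin d → Fin n) (α : Fin n) :
    content a α = (List.ofFn a).count α := by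
  rw [← content_get (List.ofFn a) List.length_ofFn]
  congr 1
  ext j
  simp

/-- A weakly increasing string is determined by the numbers of occurrences of the letters. -/
theorem eq_of_content_eq {a b : Fin d → Fin n} (ha : Monotone a) (hb : Monotone b)
    (h : ∀ α, content a α = content b α) : a = b := by
  refine List.ofFn_injective (List.Perm.eq_of_sortedLE ?_ ?_ ?_)
  · exact List.sortedLE_iff_pairwise.2 (List.pairwise_ofFn.2 fun i j hij => ha hij.le)
  · exact List.sortedLE_iff_pairwise.2 (List.pairwise_ofFn.2 fun i j hij => hb hij.le)
  · exact List.perm_iff_count.2 fun α => by rw [← content_eq_count, ← content_eq_count, h]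

theorem partialCount_le_of_le {o e : Fin d → Fin n} (h : ∀ j, o j ≤ e j) (i : ℕ) :
    partialCount e i ≤ partialCount o i :=
  Finset.card_le_card <| Finset.monotone_filter_right _ fun j _ hj =>
    lt_of_le_of_lt (Fin.le_def.1 (h j)) hj

theorem partialCount_le_succ {o e : Fin d → Fin n} (h : ∀ j j', j < j' → e j ≤ o j') (i : ℕ) :
    partialCount o i ≤ partialCount e i + 1 := by
  rw [partialCount]
  set S := Finset.univ.filter fun j => (o j : ℕ) < i with hS
  obtain hE | hne := S.eq_empty_or_nonempty
  · simp [hE]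
  -- All positions in `S` but the last one count for `e`.
  have hsub : S.erase (S.max' hne) ⊆ Finset.univ.filter fun j => (e j : ℕ) < i := by
    intro j hj
    have hlt : j < S.max' hne := Finset.lt_max'_of_mem_erase_max' S hne hj
    have hmax := (Finset.mem_filter.1 (S.max'_mem hne)).2
    exact Finset.mem_filter.2 ⟨Finset.mem_univ _, lt_of_le_of_lt (Fin.le_def.1 (h _ _ hlt)) hmax⟩
  have := Finset.card_le_card hsub
  rw [Finset.card_erase_of_mem (S.max'_mem hne)] at this
  exact Nat.sub_le_iff_le_add.1 this

theorem count_interleave (a b : Fin d → Fin n) (α : Fin n) :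
    ((List.ofFn fun j => [a j, b j]).flatten).count α = content a α + content b α := by
  rw [List.count_flatten, List.map_ofFn, List.sum_ofFn, content, content, Finset.card_filter,
    Finset.card_filter, ← Finset.sum_add_distrib]
  refine Finset.sum_congr rfl fun j _ => ?_
  simp only [Function.comp_apply, List.count_cons, List.count_nil, zero_add, beq_iff_eq]
  exact add_comm _ _

theorem pairwise_interleave {o e : Fin d → Fin n}
    (h : ((List.ofFn fun j => [o j, e j]).flatten).Pairwise (· ≤ ·)) :
    (∀ j, o j ≤ e j) ∧ (∀ j j', j < j' → o j ≤ o j' ∧ e j ≤ o j' ∧ e j ≤ e j') := by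
  rw [List.pairwise_flatten, List.pairwise_ofFn] at h
  refine ⟨fun j => ?_, fun j j' hjj => ?_⟩
  · have := h.1 [o j, e j] (List.mem_ofFn.2 ⟨j, rfl⟩)
    simpa using this
  · have := h.2 hjj
    simp only [List.mem_cons, List.not_mem_nil, or_false, forall_eq_or_imp, forall_eq] at this
    exact ⟨this.1.1, this.2.1, this.2.2⟩

theorem exists_eq_interleave (l : List (Fin n)) (hl : l.length = d * 2) :
    ∃ o e : Fin d → Fin n, l = (List.ofFn fun j => [o j, e j]).flatten := by
  have h := List.ofFn_mul fun i : Fin (d * 2) => l.get (i.cast hl.symm)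
  refine ⟨fun j => l.get ⟨j * 2, by omega⟩, fun j => l.get ⟨j * 2 + 1, by omega⟩, ?_⟩
  have h1 : l = List.ofFn fun i : Fin (d * 2) => l.get (i.cast hl.symm) :=
    List.ext_get (by simp [hl]) (by simp)
  refine h1.trans (h.trans ?_)
  simp [List.ofFn_succ]

end Strings

/-! ### Sorting pairs of strings -/

section Sorting

variable {n d : ℕ} {r : Fin n → ℕ}

theorem Str.ext_partialCount {a b : Str r d}
    (h : ∀ i ≤ n, partialCount a.1 i = partialCount b.1 i) : a = b := by
  refine Subtype.ext (eq_of_content_eq a.2.1 b.2.1 fun α => ?_)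
  have h1 := partialCount_succ a.1 α
  have h2 := partialCount_succ b.1 α
  have h3 := h (α + 1) α.2
  have h4 := h α α.2.le
  omega

theorem Str.ext_content {a b : Str r d} (h : ∀ α, content a.1 α = content b.1 α) : a = b :=
  Subtype.ext (eq_of_content_eq a.2.1 b.2.1 h)

theorem exists_sortsTo (a b : Str r d) : ∃ o e, SortsTo a b o e := by
  have hperm := List.perm_insertionSort (· ≤ ·) (interleave a b)
  have hlen : (interleave a b).length = d * 2 := by
    rw [interleave, List.length_flatten, List.map_ofFn, List.sum_ofFn]
    simp
  obtain ⟨o, e, hoe⟩ := exists_eq_interleave (d := d) ((interleave a b).insertionSort (· ≤ ·))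
    (by rw [List.length_insertionSort, hlen])
  have hsort := List.pairwise_insertionSort (· ≤ ·) (interleave a b)
  rw [hoe] at hsort hperm
  obtain ⟨h1, h2⟩ := pairwise_interleave hsort
  have ho : Monotone o := fun i j hij => hij.eq_or_lt.elim (fun h => h ▸ le_rfl) fun h => (h2 i j h).1
  have he : Monotone e :=
    fun i j hij => hij.eq_or_lt.elim (fun h => h ▸ le_rfl) fun h => (h2 i j h).2.2
  -- The occurrences of a letter are split evenly between `o` and `e`, so that the bounds persist.
  have hbound : ∀ α, content o α ≤ r α ∧ content e α ≤ r α := fun α => by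
    have h3 := hperm.count_eq α
    rw [interleave, count_interleave, count_interleave] at h3
    have h4 := partialCount_le_of_le h1 α
    have h5 := partialCount_le_of_le h1 (α + 1)
    have h6 := partialCount_le_succ (fun j j' h => (h2 j j' h).2.1) α
    have h7 := partialCount_le_succ (fun j j' h => (h2 j j' h).2.1) (α + 1)
    rw [partialCount_succ, partialCount_succ] at h5 h7
    have h8 := a.2.2 α
    have h9 := b.2.2 α
    omega
  exact ⟨⟨o, ho, fun α => (hbound α).1⟩, ⟨e, he, fun α => (hbound α).2⟩, hoe⟩

theorem SortsTo.content_add {a b o e : Str r d} (h : SortsTo a b o e) (α : Fin n) :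
    content o.1 α + content e.1 α = content a.1 α + content b.1 α := by
  have := (List.perm_insertionSort (· ≤ ·) (interleave a b)).count_eq α
  rwa [h, interleave, interleave, count_interleave, count_interleave] at this

/-- The partial counts of a sorted pair are the two halves, rounded up and down, of those of the
original pair. -/
theorem SortsTo.balanced {a b o e : Str r d} (h : SortsTo a b o e) (i : ℕ) :
    partialCount o.1 i + partialCount e.1 i = partialCount a.1 i + partialCount b.1 i ∧
      partialCount e.1 i ≤ partialCount o.1 i ∧ partialCount o.1 i ≤ partialCount e.1 i + 1 := by
  have hsort := List.pairwise_insertionSort (· ≤ ·) (interleave a b)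
  rw [h] at hsort
  obtain ⟨h1, h2⟩ := pairwise_interleave hsort
  refine ⟨?_, partialCount_le_of_le h1 i, partialCount_le_succ (fun j j' h => (h2 j j' h).2.1) i⟩
  simp only [partialCount_eq_sum, ← Finset.sum_add_distrib]
  refine Finset.sum_congr rfl fun α _ => ?_
  have := h.content_add α
  split_ifs <;> omega

theorem SortsTo.eq_of_partialCount {a b o e o' e' : Str r d} (h : SortsTo a b o e)
    (h' : ∀ i ≤ n, partialCount o'.1 i + partialCount e'.1 i =
        partialCount a.1 i + partialCount b.1 i ∧
      partialCount e'.1 i ≤ partialCount o'.1 i ∧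
        partialCount o'.1 i ≤ partialCount e'.1 i + 1) :
    o' = o ∧ e' = e := by
  constructor <;>
  · refine Str.ext_partialCount fun i hi => ?_
    have := h.balanced i
    have := h' i hi
    omega

/-- The sorting only depends on the unordered pair. -/
theorem SortsTo.unique {a b o e a' b' o' e' : Str r d} (h : SortsTo a b o e)
    (h' : SortsTo a' b' o' e') (hab : (a' = a ∧ b' = b) ∨ (a' = b ∧ b' = a)) :
    o' = o ∧ e' = e := by
  refine h.eq_of_partialCount fun i _ => ?_
  have := h'.balanced i
  rcases hab with ⟨rfl, rfl⟩ | ⟨rfl, rfl⟩ <;> omega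

/-- Sorted pairs are not changed by sorting. -/
theorem SortsTo.idem {a b o e o' e' : Str r d} (h : SortsTo a b o e) (h' : SortsTo o e o' e') :
    o = o' ∧ e = e' :=
  h'.eq_of_partialCount fun i _ => ⟨rfl, (h.balanced i).2⟩

/-- The sum of the squares of the numbers of letters in all intervals of the alphabet, each interval
being counted twice. -/
def stringWeight (a : Str r d) : ℕ :=
  ∑ x ∈ Finset.range (n + 1) ×ˢ Finset.range (n + 1),
    ((partialCount a.1 x.1 : ℤ) - partialCount a.1 x.2).natAbs ^ 2

theorem stringWeight_cast (a : Str r d) :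
    (stringWeight a : ℤ) = ∑ x ∈ Finset.range (n + 1) ×ˢ Finset.range (n + 1),
      ((partialCount a.1 x.1 : ℤ) - partialCount a.1 x.2) ^ 2 := by
  simp [stringWeight]

theorem sq_add_sq_le_of_balanced {x y p q : ℤ} (h : x + y = p + q) (h1 : p - q ≤ 1)
    (h2 : q - p ≤ 1) : p ^ 2 + q ^ 2 ≤ x ^ 2 + y ^ 2 := by
  obtain ⟨z, rfl⟩ : ∃ z, x = p + z := ⟨x - p, by ring⟩
  obtain rfl : y = q - z := by linarith
  obtain ⟨δ, rfl⟩ : ∃ δ, p = q + δ := ⟨p - q, by ring⟩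
  have : 0 ≤ z * (δ + z) := by
    rcases lt_trichotomy z 0 with hz | rfl | hz
    · exact mul_nonneg_of_nonpos_of_nonpos hz.le (by omega)
    · simp
    · exact mul_nonneg hz.le (by omega)
  nlinarith

theorem balanced_of_sq_add_sq_eq {x y p q : ℤ} (h : x + y = p + q) (h1 : p - q ≤ 1)
    (h2 : q - p ≤ 1) (hsq : p ^ 2 + q ^ 2 = x ^ 2 + y ^ 2) : x - y ≤ 1 ∧ y - x ≤ 1 := by
  have h3 : (x - y) ^ 2 = (p - q) ^ 2 := by
    linear_combination (-2) * hsq - (x + y + p + q) * h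
  rcases sq_eq_sq_iff_eq_or_eq_neg.1 h3 with h4 | h4 <;> constructor <;> linarith

/-- Sorting a pair that is not sorted decreases the weight: it makes the two numbers of letters in
each interval as equal as possible, keeping their sum, and a pair for which all these numbers differ
by at most one is sorted. -/
theorem SortsTo.stringWeight_lt {a b o e : Str r d} (h : SortsTo a b o e)
    (hne : ¬ ((o = a ∧ e = b) ∨ (o = b ∧ e = a))) :
    stringWeight o + stringWeight e < stringWeight a + stringWeight b := by
  set S := Finset.range (n + 1) ×ˢ Finset.range (n + 1) with hS
  have hterm : ∀ x ∈ S,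
      ((partialCount o.1 x.1 : ℤ) - partialCount o.1 x.2) ^ 2 +
        ((partialCount e.1 x.1 : ℤ) - partialCount e.1 x.2) ^ 2 ≤
      ((partialCount a.1 x.1 : ℤ) - partialCount a.1 x.2) ^ 2 +
        ((partialCount b.1 x.1 : ℤ) - partialCount b.1 x.2) ^ 2 := fun x _ => by
    have h1 := h.balanced x.1
    have h2 := h.balanced x.2
    exact sq_add_sq_le_of_balanced (by omega) (by omega) (by omega)
  by_contra! hle
  zify at hle
  simp only [stringWeight_cast, ← hS, ← Finset.sum_add_distrib] at hle
  have heq := (Finset.sum_eq_sum_iff_of_le hterm).1 (le_antisymm (Finset.sum_le_sum hterm) hle)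
  have hbal : ∀ i ≤ n, ∀ j ≤ n,
      ((partialCount a.1 i : ℤ) - partialCount a.1 j) -
        (partialCount b.1 i - partialCount b.1 j) ≤ 1 := fun i hi j hj => by
    have h1 := h.balanced i
    have h2 := h.balanced j
    have hij := heq (i, j) (by simp only [hS, Finset.mem_product, Finset.mem_range]; omega)
    dsimp only at hij
    exact (balanced_of_sq_add_sq_eq (by omega) (by omega) (by omega) hij).1
  -- The differences of the partial counts differ from each other by at most one, and the one at `0`
  -- vanishes, so that they all have the same sign.
  have h0 : partialCount a.1 0 = 0 ∧ partialCount b.1 0 = 0 :=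
    ⟨partialCount_zero _, partialCount_zero _⟩
  by_cases hpos : ∃ i ≤ n, partialCount b.1 i < partialCount a.1 i
  · obtain ⟨i, hi, hlt⟩ := hpos
    refine hne (Or.inl ?_)
    obtain ⟨h1, h2⟩ := h.eq_of_partialCount (o' := a) (e' := b) fun j hj => by
      have := hbal i hi j hj
      have := hbal j hj 0 (Nat.zero_le _)
      omega
    exact ⟨h1.symm, h2.symm⟩
  · push Not at hpos
    refine hne (Or.inr ?_)
    obtain ⟨h1, h2⟩ := h.eq_of_partialCount (o' := b) (e' := a) fun j hj => by
      have := hpos j hj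
      have := hbal 0 (Nat.zero_le _) j hj
      omega
    exact ⟨h1.symm, h2.symm⟩

end Sorting

/-! ### Families of pairwise sorted vectors -/

section SortedFamilies

variable {ι κ : Type*}

/-- In a nonempty family of vectors of natural numbers any two of which are comparable and differ by
at most one in each coordinate, one is the greatest. -/
theorem exists_top_of_sorted (F : ι → κ → ℕ) {M : Multiset ι} (hM : M ≠ 0)
    (h : ∀ a ∈ M, ∀ b ∈ M, (F a ≤ F b ∧ F b ≤ F a + 1) ∨ (F b ≤ F a ∧ F a ≤ F b + 1)) :
    ∃ a ∈ M, ∀ b ∈ M, F b ≤ F a ∧ F a ≤ F b + 1 := by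
  classical
  obtain ⟨a, ha, hmax⟩ := M.toFinset.exists_maximalFor F (Multiset.toFinset_nonempty.2 hM)
  refine ⟨a, Multiset.mem_toFinset.1 ha, fun b hb => ?_⟩
  rcases h a (Multiset.mem_toFinset.1 ha) b hb with hab | hba
  · exact ⟨hmax (Multiset.mem_toFinset.2 hb) hab.1, hab.1.trans (le_self_add)⟩
  · exact hba

/-- A family of pairwise sorted vectors is determined by its size and its sum: its greatest vector
is the average of the family, rounded up, and the rest follows by induction. -/
theorem eq_of_sorted_of_sum_eq (F : ι → κ → ℕ) (M N : Multiset ι)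
    (hM : ∀ a ∈ M, ∀ b ∈ M, (F a ≤ F b ∧ F b ≤ F a + 1) ∨ (F b ≤ F a ∧ F a ≤ F b + 1))
    (hN : ∀ a ∈ N, ∀ b ∈ N, (F a ≤ F b ∧ F b ≤ F a + 1) ∨ (F b ≤ F a ∧ F a ≤ F b + 1))
    (hinj : ∀ a ∈ M, ∀ b ∈ N, F a = F b → a = b) (hcard : M.card = N.card)
    (hsum : ∀ i, (M.map fun a => F a i).sum = (N.map fun a => F a i).sum) : M = N := by
  induction hD : M.card generalizing M N with
  | zero =>
    rw [Multiset.card_eq_zero.1 hD, Multiset.card_eq_zero.1 (hcard ▸ hD : N.card = 0)]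
  | succ D ih =>
    have hM0 : M ≠ 0 := by
      rintro rfl
      simp at hD
    have hN0 : N ≠ 0 := by
      rintro rfl
      simp [hD] at hcard
    obtain ⟨a, ha, hatop⟩ := exists_top_of_sorted F hM0 hM
    obtain ⟨b, hb, hbtop⟩ := exists_top_of_sorted F hN0 hN
    obtain ⟨M, rfl⟩ := Multiset.exists_cons_of_mem ha
    obtain ⟨N, rfl⟩ := Multiset.exists_cons_of_mem hb
    simp only [Multiset.card_cons, Nat.add_right_cancel_iff] at hcard hD
    simp only [Multiset.map_cons, Multiset.sum_cons] at hsum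
    have upper : ∀ (c : ι) (P : Multiset ι), (∀ x ∈ c ::ₘ P, F x ≤ F c ∧ F c ≤ F x + 1) →
        ∀ i, (P.map fun x => F x i).sum ≤ P.card * F c i := fun c P hP i => by
      have := Multiset.sum_le_card_nsmul (P.map fun x => F x i) (F c i) (by
        simp only [Multiset.mem_map, forall_exists_index, and_imp, forall_apply_eq_imp_iff₂]
        exact fun x hx => (hP x (Multiset.mem_cons_of_mem hx)).1 i)
      simpa using this
    have lower : ∀ (c : ι) (P : Multiset ι), (∀ x ∈ c ::ₘ P, F x ≤ F c ∧ F c ≤ F x + 1) →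
        ∀ i, P.card * F c i ≤ (P.map fun x => F x i).sum + P.card := fun c P hP i => by
      have := Multiset.card_nsmul_le_sum (s := P.map fun x => F x i + 1) (a := F c i) (by
        simp only [Multiset.mem_map, forall_exists_index, and_imp, forall_apply_eq_imp_iff₂]
        exact fun x hx => (hP x (Multiset.mem_cons_of_mem hx)).2 i)
      simpa [Multiset.sum_map_add] using this
    obtain rfl : a = b := by
      refine hinj a ha b hb (funext fun i => ?_)
      have h1 := upper a M hatop i
      have h2 := lower a M hatop i
      have h3 := upper b N hbtop i
      have h4 := lower b N hbtop i
      have h5 := hsum i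
      rw [← hcard] at h3 h4
      rcases lt_trichotomy (F a i) (F b i) with hlt | heq | hlt
      · nlinarith [Nat.mul_le_mul_left M.card hlt]
      · exact heq
      · nlinarith [Nat.mul_le_mul_left M.card hlt]
    rw [ih M N (fun x hx y hy => hM x (Multiset.mem_cons_of_mem hx) y (Multiset.mem_cons_of_mem hy))
      (fun x hx y hy => hN x (Multiset.mem_cons_of_mem hx) y (Multiset.mem_cons_of_mem hy))
      (fun x hx y hy => hinj x (Multiset.mem_cons_of_mem hx) y (Multiset.mem_cons_of_mem hy))
      hcard (fun i => Nat.add_left_cancel (hsum i)) hD]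

end SortedFamilies

/-! ### The orbit ideal as the kernel of a monomial map -/

section OrbitIdeal

variable {n d : ℕ} {r : Fin n → ℕ}

theorem content_word (u : Pl r d) (α : Fin n) : content (word u).1 α = blockCount u α :=
  (mem_block_word u α).symm

theorem mem_block_iff {a : Str r d} {u : Pl r d} : u ∈ block a ↔ word u = a :=
  ⟨fun h => Str.ext_content fun α => (content_word u α).trans (h α), fun h => h ▸ mem_block_word u⟩

/-- The exponent of the monomial in `t` by which the torus acts on the coordinate `u`. -/
noncomputable def torusExponent (u : Pl r d) : Fin n →₀ ℕ :=
  Finsupp.equivFunOnFinite.symm (blockCount u)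

/-- The multidegree of a monomial in the Plücker coordinates with respect to the torus. -/
noncomputable def torusDegree : (Pl r d →₀ ℕ) →+ (Fin n →₀ ℕ) :=
  Finsupp.weight torusExponent

variable {k : Type*} [Field k]

/-- The homomorphism `z_u ↦ p_u t^{i(u)}`, whose kernel is the orbit ideal. -/
noncomputable def orbitHom (p : Pl r d → k) :
    MvPolynomial (Pl r d) k →ₐ[k] MvPolynomial (Fin n) k :=
  aeval fun u => monomial (torusExponent u) (p u)

theorem rho_comp_zeta (p : Pl r d → k) : (rho k r d).comp (zeta p) = orbitHom p := by
  refine algHom_ext fun u => ?_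
  rw [AlgHom.comp_apply, zeta, aeval_X, map_mul, rho, aeval_X, orbitHom, aeval_X, monomial_eq,
    Finsupp.prod_fintype _ _ fun _ => pow_zero _]
  simp only [algHom_C, algebraMap_eq, content_word]
  rfl

theorem mem_orbitIdeal_iff {p : Pl r d → k} {f : MvPolynomial (Pl r d) k} :
    f ∈ orbitIdeal p ↔ orbitHom p f = 0 := by
  rw [← rho_comp_zeta, orbitIdeal, RingHom.mem_ker]
  exact Ideal.Quotient.eq_zero_iff_mem.trans RingHom.mem_ker

theorem orbitHom_monomial (p : Pl r d → k) (s : Pl r d →₀ ℕ) (c : k) :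
    orbitHom p (monomial s c) = monomial (torusDegree s) (c * s.prod fun u i => p u ^ i) := by
  rw [orbitHom, aeval_monomial, torusDegree, Finsupp.weight_apply, algebraMap_eq,
    ← C_mul_monomial]
  congr 1
  simp only [monomial_pow, Finsupp.prod, Finsupp.sum]
  induction s.support using Finset.cons_induction with
  | empty => simp
  | cons u S hu ih => rw [Finset.prod_cons, ih, monomial_mul, Finset.sum_cons, Finset.prod_cons]

/-- A term of an element of the orbit ideal is never the only one of its multidegree, because the
images of the terms of one multidegree are multiples of the same monomial and have to cancel. -/
theorem exists_ne_torusDegree_eq {p : Pl r d → k} (hp : ∀ u, p u ≠ 0)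
    {f : MvPolynomial (Pl r d) k} (hf : f ∈ orbitIdeal p) {s : Pl r d →₀ ℕ} (hs : s ∈ f.support) :
    ∃ t ∈ f.support, t ≠ s ∧ torusDegree t = torusDegree s := by
  classical
  by_contra! h
  have h0 := congrArg (coeff (torusDegree s)) (mem_orbitIdeal_iff.1 hf)
  conv_lhs at h0 => rw [f.as_sum]
  simp only [map_sum, orbitHom_monomial, coeff_sum, coeff_monomial, coeff_zero] at h0
  rw [Finset.sum_eq_single s (fun t ht hts => if_neg (h t ht hts)) (fun h => absurd hs h),
    if_pos rfl] at h0
  exact mul_ne_zero (mem_support_iff.1 hs)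
    (Finset.prod_ne_zero_iff.2 fun u _ => pow_ne_zero _ (hp u)) h0

theorem aeval_orbitHom {K : Type*} [Field K] [Algebra k K] (p : Pl r d → k) (t : Fin n → K)
    (f : MvPolynomial (Pl r d) k) : aeval t (orbitHom p f) =
      aeval (fun u => (∏ α, t α ^ blockCount u α) * algebraMap k K (p u)) f := by
  have h : (aeval t).comp (orbitHom p) =
      aeval (R := k) fun u => (∏ α, t α ^ blockCount u α) * algebraMap k K (p u) := by
    refine algHom_ext fun u => ?_
    rw [AlgHom.comp_apply, orbitHom, aeval_X, aeval_X, aeval_monomial, mul_comm,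
      Finsupp.prod_fintype _ _ fun _ => pow_zero _]
    rfl
  exact DFunLike.congr_fun h f

theorem eq_zero_of_aeval_units_eq_zero {σ K : Type*} [Field K] [Infinite K] [Algebra k K]
    {g : MvPolynomial σ k} (h : ∀ t : σ → Kˣ, aeval (fun i => (t i : K)) g = 0) : g = 0 := by
  refine map_injective (algebraMap k K) (algebraMap k K).injective ?_
  rw [map_zero]
  refine funext_set (fun _ => {0}ᶜ) (fun _ => (Set.finite_singleton 0).infinite_compl)
    fun x hx => ?_
  have hx' : ∀ i, x i ≠ 0 := fun i => hx i (Set.mem_univ i)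
  have := h fun i => Units.mk0 (x i) (hx' i)
  rw [map_zero, eval_map, ← aeval_def]
  simpa using this

theorem sum_blockCount (u : Pl r d) : ∑ α, blockCount u α = d := by
  simp only [← content_word, sum_content]

theorem orbitIdeal_eq_vanishingIdeal (hd : 1 ≤ d) (p : Pl r d → k) :
    orbitIdeal p = vanishingIdeal k (orbitCone p) := by
  ext f
  rw [mem_orbitIdeal_iff, mem_vanishingIdeal_iff]
  constructor
  · rintro hf z ⟨c, t, hz⟩
    -- The scalar `c` is absorbed into `t`, as all coordinates have torus degree `d`.
    obtain ⟨c', hc⟩ := IsAlgClosed.exists_pow_nat_eq (c : AlgebraicClosure k) hd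
    have h := aeval_orbitHom p (fun α => c' * (t α : AlgebraicClosure k)) f
    rw [hf, map_zero] at h
    rw [h]
    congr 2
    ext u
    simp only [hz, mul_pow, Finset.prod_mul_distrib, Finset.prod_pow_eq_pow_sum, sum_blockCount, hc]
  · intro h
    refine eq_zero_of_aeval_units_eq_zero (K := AlgebraicClosure k) fun t => ?_
    rw [aeval_orbitHom]
    exact h _ ⟨1, t, fun u => by rw [Units.val_one, one_mul]⟩

theorem sum_map_toMultiset (g : Pl r d → ℕ) (s : Pl r d →₀ ℕ) :
    ((Finsupp.toMultiset s).map g).sum = Finsupp.weight g s := by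
  rw [Finsupp.toMultiset_map, Finsupp.sum_toMultiset, Finsupp.weight_apply]
  exact Finsupp.sum_mapDomain_index (fun _ => zero_smul ℕ _) fun _ _ _ => add_smul _ _ _

theorem weight_partialCount (i : ℕ) (s : Pl r d →₀ ℕ) :
    Finsupp.weight (fun u => partialCount (word u).1 i) s =
      ∑ α : Fin n, if (α : ℕ) < i then torusDegree s α else 0 := by
  simp only [torusDegree, Finsupp.weight_apply, Finsupp.sum, Finsupp.finsetSum_apply,
    partialCount_eq_sum, content_word, Finset.smul_sum]
  rw [Finset.sum_comm]
  refine Finset.sum_congr rfl fun α _ => ?_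
  split_ifs
  · rfl
  · simp

end OrbitIdeal

/-! ### The term order on the Plücker coordinates -/

section Order

variable {n d : ℕ} {r : Fin n → ℕ} (ord : ∀ a : Str r d, MonomialOrder.{0, w} (block a))

theorem word_blockMin (a : Str r d) : word (blockMin ord a) = a :=
  mem_block_iff.1 (Subtype.prop _)

theorem blockMin_injective : Function.Injective (blockMin ord) :=
  Function.LeftInverse.injective (word_blockMin ord)

/-- The term order comparing first the total weights of the strings of the variables and then, one
after the other, the parts of the monomials in the single blocks. -/
noncomputable def plOrder : MonomialOrder.{0, 0} (Pl r d) :=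
  weightBlockOrder (fun i => block ((Finite.equivFin (Str r d)).symm i))
    (fun u => stringWeight (word u)) (fun i => ord ((Finite.equivFin (Str r d)).symm i))
    fun u => ⟨Finite.equivFin (Str r d) (word u), by
      rw [Equiv.symm_apply_apply]
      exact mem_block_word u⟩

theorem weight_mapDomain_block (a : Str r d) (s : block a →₀ ℕ) :
    Finsupp.weight (fun u => stringWeight (word u)) (s.mapDomain Subtype.val) =
      s.degree * stringWeight a := by
  rw [Finsupp.weight_apply, Finsupp.degree_apply, Finset.sum_mul]
  refine (Finsupp.sum_mapDomain_index (h := fun u i => i • stringWeight (word u))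
    (fun _ => zero_smul ℕ _) fun _ _ _ => add_smul _ _ _).trans (Finset.sum_congr rfl fun u _ => ?_)
  simp only [mem_block_iff.1 u.2, smul_eq_mul]

theorem subtypeDomain_mapDomain_block (a : Str r d) (s : block a →₀ ℕ) :
    (s.mapDomain Subtype.val).subtypeDomain (fun x => x ∈ block a) = s :=
  Finsupp.ext fun x => Finsupp.mapDomain_apply Subtype.val_injective s x

theorem plOrder_extends : ExtendsBlockOrders ord (plOrder ord) := by
  intro a s t hst
  obtain ⟨i, rfl⟩ := (Finite.equivFin (Str r d)).symm.surjective a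
  rw [plOrder, weightBlockOrder_lt_iff _ _ _ _ i
    (by rw [weight_mapDomain_block, weight_mapDomain_block, hst])]
  · rw [subtypeDomain_mapDomain_block, subtypeDomain_mapDomain_block]
  · intro j hj x hx
    have hx' : x ∉ Set.range
        (Subtype.val : block ((Finite.equivFin (Str r d)).symm i) → Pl r d) := by
      rintro ⟨y, rfl⟩
      exact hj ((Finite.equivFin (Str r d)).symm.injective
        ((mem_block_iff.1 hx).symm.trans (mem_block_iff.1 y.2)))
    rw [Finsupp.mapDomain_of_notMem_range _ _ hx', Finsupp.mapDomain_of_notMem_range _ _ hx']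

theorem plOrder_single_lt {u : Pl r d} (hu : u ≠ blockMin ord (word u)) :
    (plOrder ord).toSyn (Finsupp.single (blockMin ord (word u)) 1) <
      (plOrder ord).toSyn (Finsupp.single u 1) := by
  have h := (plOrder_extends ord (word u) (Finsupp.single (Function.argmin fun v : block (word u) =>
    (ord (word u)).toSyn (Finsupp.single v 1)) 1) (Finsupp.single ⟨u, mem_block_word u⟩ 1)
    (by simp)).2 ?_
  · rw [Finsupp.mapDomain_single, Finsupp.mapDomain_single] at h
    exact h
  · refine lt_of_le_of_ne (Function.argmin_le (fun v : block (word u) =>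
      (ord (word u)).toSyn (Finsupp.single v 1)) _) fun h => hu ?_
    have h1 := (Finsupp.single_left_inj one_ne_zero).1 ((ord (word u)).toSyn.injective h)
    exact (congrArg Subtype.val h1).symm

/-- The exponent of the monomial `z_{u_a} z_{u_b}`. -/
noncomputable def pairExponent (a b : Str r d) : Pl r d →₀ ℕ :=
  Finsupp.single (blockMin ord a) 1 + Finsupp.single (blockMin ord b) 1

theorem pairExponent_eq_iff {a b a' b' : Str r d} :
    pairExponent ord a b = pairExponent ord a' b' ↔ (a = a' ∧ b = b') ∨ (a = b' ∧ b = a') := by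
  rw [pairExponent, pairExponent,
    Finsupp.single_add_single_eq_single_add_single one_ne_zero one_ne_zero]
  simp [(blockMin_injective ord).eq_iff]

theorem plOrder_pair_lt {a b o e : Str r d} (h : SortsTo a b o e)
    (hne : ¬ ((o = a ∧ e = b) ∨ (o = b ∧ e = a))) :
    (plOrder ord).toSyn (pairExponent ord o e) < (plOrder ord).toSyn (pairExponent ord a b) := by
  refine weightBlockOrder_lt_of_weight_lt _ _ _ _ ?_
  simpa [pairExponent, Finsupp.weight_single, word_blockMin] using h.stringWeight_lt hne

end Order

/-! ### The binomials -/

section Binomials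

variable {n d : ℕ} {r : Fin n → ℕ} (ord : ∀ a : Str r d, MonomialOrder.{0, w} (block a))
  {k : Type*} [Field k] (p : Pl r d → k)

theorem C_mul_linBinomial (c : k) (a : Str r d) (u : Pl r d) :
    C c * linBinomial ord p a u = monomial (Finsupp.single u 1) (c * p (blockMin ord a)) -
      monomial (Finsupp.single (blockMin ord a) 1) (c * p u) := by
  simp only [linBinomial, X, mul_sub, C_mul_monomial, mul_one]

theorem C_mul_quadBinomial (c : k) (a b o e : Str r d) :
    C c * quadBinomial ord p a b o e =
      monomial (pairExponent ord a b) (c * (p (blockMin ord o) * p (blockMin ord e))) -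
        monomial (pairExponent ord o e) (c * (p (blockMin ord a) * p (blockMin ord b))) := by
  simp only [quadBinomial, X, mul_sub, C_mul_monomial, monomial_mul, mul_one, pairExponent]

theorem linBinomial_mem (a : Str r d) {u : Pl r d} (hu : u ∈ block a) :
    linBinomial ord p a u ∈ orbitIdeal p := by
  have h : torusExponent (blockMin ord a) = torusExponent u :=
    congrArg Finsupp.equivFunOnFinite.symm (funext fun α => by
      rw [← content_word, word_blockMin, hu α])
  rw [mem_orbitIdeal_iff, linBinomial, map_sub, map_mul, map_mul, algHom_C, algHom_C, orbitHom,
    aeval_X, aeval_X, algebraMap_eq, C_mul_monomial, C_mul_monomial, h, mul_comm, sub_self]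

theorem quadBinomial_mem {a b o e : Str r d} (h : SortsTo a b o e) :
    quadBinomial ord p a b o e ∈ orbitIdeal p := by
  have h : torusExponent (blockMin ord a) + torusExponent (blockMin ord b) =
      torusExponent (blockMin ord o) + torusExponent (blockMin ord e) := by
    ext α
    change blockCount _ α + blockCount _ α = blockCount _ α + blockCount _ α
    simp only [← content_word, word_blockMin, h.content_add]
  rw [mem_orbitIdeal_iff, quadBinomial]
  simp only [map_sub, map_mul, algHom_C, orbitHom, aeval_X, algebraMap_eq, mul_assoc,
    C_mul_monomial, monomial_mul, h]
  rw [sub_eq_zero]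
  congr 1
  ring

theorem linBinomial_eq_zero {a : Str r d} {u : Pl r d} (h : u = blockMin ord a) :
    linBinomial ord p a u = 0 := by
  rw [h]
  exact sub_self _

theorem quadBinomial_eq_zero {a b o e : Str r d} (h : (o = a ∧ e = b) ∨ (o = b ∧ e = a)) :
    quadBinomial ord p a b o e = 0 := by
  rcases h with ⟨rfl, rfl⟩ | ⟨rfl, rfl⟩
  · exact sub_self _
  · rw [quadBinomial, mul_comm (p (blockMin ord o)), mul_right_comm, sub_self]

/-- The nonzero linear and quadratic binomials, multiplied by constants that only depend on the
block and on the sorted pair, respectively. -/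
def scaledBinomials (c : Str r d → k) (q : Str r d → Str r d → k) : Set (MvPolynomial (Pl r d) k) :=
  ({f | ∃ a, ∃ u ∈ block a, f = C (c a) * linBinomial ord p a u} ∪
    {f | ∃ a b o e, SortsTo a b o e ∧ f = C (q o e) * quadBinomial ord p a b o e}) \ {0}

variable {p} {c : Str r d → k} {q : Str r d → Str r d → k}

theorem finite_scaledBinomials : (scaledBinomials ord p c q).Finite := by
  refine Set.Finite.subset ((Set.finite_range fun x : Str r d × Pl r d =>
    C (c x.1) * linBinomial ord p x.1 x.2).union
      (Set.finite_range fun x : (Str r d × Str r d) × (Str r d × Str r d) =>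
        C (q x.2.1 x.2.2) * quadBinomial ord p x.1.1 x.1.2 x.2.1 x.2.2)) ?_
  rintro f ⟨⟨a, u, -, rfl⟩ | ⟨a, b, o, e, -, rfl⟩, -⟩
  · exact Or.inl ⟨(a, u), rfl⟩
  · exact Or.inr ⟨((a, b), (o, e)), rfl⟩

theorem scaledBinomials_subset :
    scaledBinomials ord p c q ⊆ (orbitIdeal p : Set (MvPolynomial (Pl r d) k)) := by
  rintro f ⟨⟨a, u, hu, rfl⟩ | ⟨a, b, o, e, h, rfl⟩, -⟩
  · exact Ideal.mul_mem_left _ _ (linBinomial_mem ord p a hu)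
  · exact Ideal.mul_mem_left _ _ (quadBinomial_mem ord p h)

/-- The nonzero binomials are those for a variable that is not the smallest of its block and those
for a pair that is not sorted. -/
theorem mem_scaledBinomials_iff (hp : ∀ u, p u ≠ 0) (hc : ∀ a, c a ≠ 0) (hq : ∀ o e, q o e ≠ 0)
    {f : MvPolynomial (Pl r d) k} : f ∈ scaledBinomials ord p c q ↔
      (∃ u, u ≠ blockMin ord (word u) ∧ f = C (c (word u)) * linBinomial ord p (word u) u) ∨
      ∃ a b o e, SortsTo a b o e ∧ ¬ ((o = a ∧ e = b) ∨ (o = b ∧ e = a)) ∧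
        f = C (q o e) * quadBinomial ord p a b o e := by
  constructor
  · rintro ⟨⟨a, u, hu, rfl⟩ | ⟨a, b, o, e, h, rfl⟩, h0⟩
    · obtain rfl := mem_block_iff.1 hu
      refine Or.inl ⟨u, fun h => h0 ?_, rfl⟩
      rw [Set.mem_singleton_iff, linBinomial_eq_zero ord p h, mul_zero]
    · refine Or.inr ⟨a, b, o, e, h, fun h => h0 ?_, rfl⟩
      rw [Set.mem_singleton_iff, quadBinomial_eq_zero ord p h, mul_zero]
  · rintro (⟨u, hu, rfl⟩ | ⟨a, b, o, e, h, hne, rfl⟩)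
    · refine ⟨Or.inl ⟨word u, u, mem_block_word u, rfl⟩, fun h0 => ?_⟩
      have h1 := leadingCoeff_binomial (c := c (word u) * p (blockMin ord (word u)))
        (c' := c (word u) * p u) (plOrder_single_lt ord hu) (mul_ne_zero (hc _) (hp _))
      rw [← C_mul_linBinomial, Set.mem_singleton_iff.1 h0, MonomialOrder.leadingCoeff_zero] at h1
      exact mul_ne_zero (hc _) (hp _) h1.symm
    · refine ⟨Or.inr ⟨a, b, o, e, h, rfl⟩, fun h0 => ?_⟩
      have hne' : q o e * (p (blockMin ord o) * p (blockMin ord e)) ≠ 0 :=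
        mul_ne_zero (hq _ _) (mul_ne_zero (hp _) (hp _))
      have h1 := leadingCoeff_binomial (c' := q o e * (p (blockMin ord a) * p (blockMin ord b)))
        (plOrder_pair_lt ord h hne) hne'
      rw [← C_mul_quadBinomial, Set.mem_singleton_iff.1 h0, MonomialOrder.leadingCoeff_zero] at h1
      exact hne' h1.symm

theorem degree_linBinomial (hp : ∀ u, p u ≠ 0) {x : k} (hx : x ≠ 0) {u : Pl r d}
    (hu : u ≠ blockMin ord (word u)) :
    (plOrder ord).degree (C x * linBinomial ord p (word u) u) = Finsupp.single u 1 := by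
  rw [C_mul_linBinomial]
  exact degree_binomial (plOrder_single_lt ord hu) (mul_ne_zero hx (hp _))

theorem degree_quadBinomial (hp : ∀ u, p u ≠ 0) {x : k} (hx : x ≠ 0) {a b o e : Str r d}
    (h : SortsTo a b o e) (hne : ¬ ((o = a ∧ e = b) ∨ (o = b ∧ e = a))) :
    (plOrder ord).degree (C x * quadBinomial ord p a b o e) = pairExponent ord a b := by
  rw [C_mul_quadBinomial]
  exact degree_binomial (plOrder_pair_lt ord h hne) (mul_ne_zero hx (mul_ne_zero (hp _) (hp _)))

/-- A monomial that no initial monomial of the binomials divides only involves the smallest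
variables of the blocks, and their strings are pairwise sorted. -/
theorem sorted_of_standard (hp : ∀ u, p u ≠ 0) (hc : ∀ a, c a ≠ 0) (hq : ∀ o e, q o e ≠ 0)
    {s : Pl r d →₀ ℕ}
    (hs : ∀ g ∈ scaledBinomials ord p c q, ¬ (plOrder ord).degree g ≤ s) :
    (∀ u ∈ s.support, u = blockMin ord (word u)) ∧ ∀ u ∈ s.support, ∀ v ∈ s.support,
      (partialCount (word u).1 ≤ partialCount (word v).1 ∧
          partialCount (word v).1 ≤ partialCount (word u).1 + 1) ∨
        (partialCount (word v).1 ≤ partialCount (word u).1 ∧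
          partialCount (word u).1 ≤ partialCount (word v).1 + 1) := by
  classical
  have hmin : ∀ u ∈ s.support, u = blockMin ord (word u) := fun u hu => by
    by_contra hne
    refine hs _ ((mem_scaledBinomials_iff ord hp hc hq).2 (Or.inl ⟨u, hne, rfl⟩)) ?_
    rw [degree_linBinomial ord hp (hc _) hne, Finsupp.single_le_iff]
    exact Nat.one_le_iff_ne_zero.2 (Finsupp.mem_support_iff.1 hu)
  refine ⟨hmin, fun u hu v hv => ?_⟩
  obtain rfl | huv := eq_or_ne u v
  · exact Or.inl ⟨le_rfl, le_self_add⟩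
  obtain ⟨o, e, h⟩ := exists_sortsTo (word u) (word v)
  by_cases hoe : (o = word u ∧ e = word v) ∨ (o = word v ∧ e = word u)
  · rcases hoe with ⟨rfl, rfl⟩ | ⟨rfl, rfl⟩
    · exact Or.inr ⟨fun i => (h.balanced i).2.1, fun i => (h.balanced i).2.2⟩
    · exact Or.inl ⟨fun i => (h.balanced i).2.1, fun i => (h.balanced i).2.2⟩
  · exfalso
    refine hs _ ((mem_scaledBinomials_iff ord hp hc hq).2
      (Or.inr ⟨word u, word v, o, e, h, hoe, rfl⟩)) ?_
    rw [degree_quadBinomial ord hp (hq _ _) h hoe, pairExponent, ← hmin u hu, ← hmin v hv]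
    intro x
    have h1 := Finsupp.mem_support_iff.1 hu
    have h2 := Finsupp.mem_support_iff.1 hv
    rw [Finsupp.add_apply, Finsupp.single_apply, Finsupp.single_apply]
    split_ifs with hux hvx hvx
    · exact absurd (hux.trans hvx.symm) huv
    · subst hux
      omega
    · subst hvx
      omega
    · omega

/-- Each multidegree contains at most one standard monomial. -/
theorem standard_unique (hd : 1 ≤ d) (hp : ∀ u, p u ≠ 0) (hc : ∀ a, c a ≠ 0)
    (hq : ∀ o e, q o e ≠ 0) {s t : Pl r d →₀ ℕ}
    (hs : ∀ g ∈ scaledBinomials ord p c q, ¬ (plOrder ord).degree g ≤ s)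
    (ht : ∀ g ∈ scaledBinomials ord p c q, ¬ (plOrder ord).degree g ≤ t)
    (hst : torusDegree s = torusDegree t) : s = t := by
  classical
  obtain ⟨hs1, hs2⟩ := sorted_of_standard ord hp hc hq hs
  obtain ⟨ht1, ht2⟩ := sorted_of_standard ord hp hc hq ht
  have hsum : ∀ i, ((Finsupp.toMultiset s).map fun u => partialCount (word u).1 i).sum =
      ((Finsupp.toMultiset t).map fun u => partialCount (word u).1 i).sum := fun i => by
    rw [sum_map_toMultiset, sum_map_toMultiset, weight_partialCount, weight_partialCount, hst]
  refine Multiset.toFinsupp.symm.injective (eq_of_sorted_of_sum_eq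
    (fun u => partialCount (word u).1) (Finsupp.toMultiset s) (Finsupp.toMultiset t)
    ?_ ?_ ?_ ?_ hsum)
  · simpa only [Finsupp.mem_toMultiset] using hs2
  · simpa only [Finsupp.mem_toMultiset] using ht2
  · intro u hu v hv huv
    rw [Finsupp.mem_toMultiset] at hu hv
    rw [hs1 u hu, ht1 v hv, Str.ext_partialCount fun i _ => congrFun huv i]
  · -- All variables have torus degree `d ≠ 0`, so that the multidegree determines the degree.
    have h := hsum n
    simp only [partialCount_length, Multiset.map_const', Multiset.sum_replicate, smul_eq_mul] at h
    exact Nat.eq_of_mul_eq_mul_right hd h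

/-- A monomial that is not the smallest of its multidegree is divisible by an initial monomial of
one of the binomials: the smallest one is standard, since replacing the initial term of a binomial
by the other one preserves the multidegree. -/
theorem exists_degree_le_of_lt (hd : 1 ≤ d) (hp : ∀ u, p u ≠ 0) (hc : ∀ a, c a ≠ 0)
    (hq : ∀ o e, q o e ≠ 0) {s t : Pl r d →₀ ℕ}
    (hlt : (plOrder ord).toSyn t < (plOrder ord).toSyn s) (hst : torusDegree t = torusDegree s) :
    ∃ g ∈ scaledBinomials ord p c q, (plOrder ord).degree g ≤ s := by
  by_contra! hs
  obtain ⟨x, hx, hmin⟩ := exists_minimalFor_of_wellFoundedLT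
    (fun x => torusDegree x = torusDegree s) (plOrder ord).toSyn ⟨s, rfl⟩
  have hstd : ∀ g ∈ scaledBinomials ord p c q, ¬ (plOrder ord).degree g ≤ x := by
    intro g hg hle
    have hg0 : g ≠ 0 := fun h => hg.2 h
    obtain ⟨y, hy, hne, hdeg⟩ := exists_ne_torusDegree_eq hp (scaledBinomials_subset ord hg)
      ((plOrder ord).degree_mem_support hg0)
    obtain ⟨v, rfl⟩ := exists_add_of_le hle
    have hylt : (plOrder ord).toSyn (y + v) < (plOrder ord).toSyn ((plOrder ord).degree g + v) := by
      rw [map_add, map_add]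
      exact add_lt_add_left (lt_of_le_of_ne ((plOrder ord).le_degree hy)
        fun h => hne ((plOrder ord).toSyn.injective h)) _
    refine hylt.not_ge (hmin ?_ hylt.le)
    change torusDegree _ = _
    rw [← hx, map_add, map_add, hdeg]
  obtain rfl := standard_unique ord hd hp hc hq hstd hs hx
  exact hlt.not_ge (hmin hst hlt.le)

theorem isGroebnerBasis_scaledBinomials (hd : 1 ≤ d) (hp : ∀ u, p u ≠ 0) (hc : ∀ a, c a ≠ 0)
    (hq : ∀ o e, q o e ≠ 0) :
    IsGroebnerBasis (plOrder ord) (scaledBinomials ord p c q) (orbitIdeal p) := by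
  refine isGroebnerBasis_of_degree_le (finite_scaledBinomials ord) (scaledBinomials_subset ord)
    (fun h => h.2 rfl) fun f hf hf0 => ?_
  obtain ⟨t, ht, hne, hdeg⟩ :=
    exists_ne_torusDegree_eq hp hf ((plOrder ord).degree_mem_support hf0)
  exact exists_degree_le_of_lt ord hd hp hc hq (lt_of_le_of_ne ((plOrder ord).le_degree ht)
    fun h => hne ((plOrder ord).toSyn.injective h)) hdeg

theorem degree_pairExponent (a b : Str r d) : (pairExponent ord a b).degree = 2 := by
  simp [pairExponent]

theorem isReducedGroebnerBasis_scaledBinomials (hd : 1 ≤ d) (hp : ∀ u, p u ≠ 0)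
    (hc : ∀ a, c a ≠ 0) (hq : ∀ o e, q o e ≠ 0) :
    IsReducedGroebnerBasis (plOrder ord) (scaledBinomials ord p c q) (orbitIdeal p) := by
  refine ⟨isGroebnerBasis_scaledBinomials ord hd hp hc hq, fun g hg g' hg' hne s hs hle => hne ?_⟩
  rw [mem_scaledBinomials_iff ord hp hc hq] at hg hg'
  -- The variables `z_{u_a}` are not divisible by any linear initial monomial.
  have hvar : ∀ u, u ≠ blockMin ord (word u) → ∀ a, u ≠ blockMin ord a := fun u hu a h =>
    hu (by rw [h, word_blockMin])
  rcases hg with ⟨u, hu, rfl⟩ | ⟨a, b, o, e, h, hoe, rfl⟩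
  · rw [degree_linBinomial ord hp (hc _) hu, Finsupp.single_le_iff] at hle
    rcases hg' with ⟨u', hu', rfl⟩ | ⟨a', b', o', e', h', hoe', rfl⟩
    · rw [C_mul_linBinomial] at hs
      obtain rfl | rfl := support_binomial_subset hs
      · have : u' = u := by
          by_contra hne
          rw [Finsupp.single_eq_of_ne (Ne.symm hne)] at hle
          omega
        rw [this]
      · rw [Finsupp.single_eq_of_ne (hvar u hu _)] at hle
        omega
    · rw [C_mul_quadBinomial] at hs
      obtain rfl | rfl := support_binomial_subset hs <;>
      · rw [pairExponent, Finsupp.add_apply, Finsupp.single_eq_of_ne (hvar u hu _),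
          Finsupp.single_eq_of_ne (hvar u hu _)] at hle
        omega
  · rw [degree_quadBinomial ord hp (hq _ _) h hoe] at hle
    obtain ⟨v, rfl⟩ := exists_add_of_le hle
    rcases hg' with ⟨u', hu', rfl⟩ | ⟨a', b', o', e', h', hoe', rfl⟩
    · rw [C_mul_linBinomial] at hs
      obtain hv | hv := support_binomial_subset hs <;>
      · have := congrArg Finsupp.degree hv
        rw [map_add, degree_pairExponent, Finsupp.degree_single] at this
        omega
    · rw [C_mul_quadBinomial] at hs
      have hv0 : v = 0 := by
        obtain hv | hv := support_binomial_subset hs <;>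
        · have := congrArg Finsupp.degree hv
          rw [map_add, degree_pairExponent, degree_pairExponent] at this
          exact (Finsupp.degree_eq_zero_iff v).1 (by omega)
      rw [hv0, add_zero] at hs
      obtain hv | hv := support_binomial_subset hs
      · rw [pairExponent_eq_iff] at hv
        obtain ⟨rfl, rfl⟩ := h'.unique h hv
        rw [C_mul_quadBinomial, C_mul_quadBinomial, (pairExponent_eq_iff ord).2 hv]
        rcases hv with ⟨rfl, rfl⟩ | ⟨rfl, rfl⟩
        · rfl
        · rw [mul_comm (p (blockMin ord a))]
      · -- The other terms belong to sorted pairs, so that sorting does not change them.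
        rw [pairExponent_eq_iff] at hv
        obtain ⟨o'', e'', h''⟩ := exists_sortsTo o' e'
        obtain ⟨rfl, rfl⟩ := h'.idem h''
        obtain ⟨rfl, rfl⟩ := h''.unique h hv
        exact absurd (hv.imp (fun h => ⟨h.1.symm, h.2.symm⟩) fun h => ⟨h.2.symm, h.1.symm⟩) hoe

theorem groebnerSet_eq_scaledBinomials :
    groebnerSet ord p = scaledBinomials ord p (fun _ => 1) fun _ _ => 1 := by
  simp only [groebnerSet, scaledBinomials, map_one, one_mul]

theorem monic_of_mem_monicGroebnerSet (hp : ∀ u, p u ≠ 0) {g : MvPolynomial (Pl r d) k}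
    (hg : g ∈ monicGroebnerSet ord p) : (plOrder ord).Monic g := by
  change g ∈ scaledBinomials ord p (fun a => (p (blockMin ord a))⁻¹)
    (fun o e => (p (blockMin ord o) * p (blockMin ord e))⁻¹) at hg
  have hpp : ∀ o e, p (blockMin ord o) * p (blockMin ord e) ≠ 0 :=
    fun o e => mul_ne_zero (hp _) (hp _)
  rw [mem_scaledBinomials_iff ord hp (fun a => inv_ne_zero (hp _))
    (fun o e => inv_ne_zero (hpp o e))] at hg
  rcases hg with ⟨u, hu, rfl⟩ | ⟨a, b, o, e, h, hoe, rfl⟩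
  · rw [C_mul_linBinomial, inv_mul_cancel₀ (hp _)]
    exact leadingCoeff_binomial (plOrder_single_lt ord hu) one_ne_zero
  · rw [C_mul_quadBinomial, inv_mul_cancel₀ (hpp o e)]
    exact leadingCoeff_binomial (plOrder_pair_lt ord h hoe) one_ne_zero

theorem leadingTerm_linBinomial (hp : ∀ u, p u ≠ 0) {a : Str r d} {u : Pl r d} (hu : u ∈ block a)
    (h0 : linBinomial ord p a u ≠ 0) :
    (plOrder ord).leadingTerm (linBinomial ord p a u) = C (p (blockMin ord a)) * X u := by
  obtain rfl := mem_block_iff.1 hu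
  have hne : u ≠ blockMin ord (word u) := fun h => h0 (linBinomial_eq_zero ord p h)
  have h1 := C_mul_linBinomial ord p 1 (word u) u
  rw [map_one, one_mul, one_mul, one_mul] at h1
  rw [h1, leadingTerm_binomial (plOrder_single_lt ord hne) (hp _), X, C_mul_monomial, mul_one]

theorem leadingTerm_quadBinomial (hp : ∀ u, p u ≠ 0) {a b o e : Str r d} (h : SortsTo a b o e)
    (h0 : quadBinomial ord p a b o e ≠ 0) :
    (plOrder ord).leadingTerm (quadBinomial ord p a b o e) =
      C (p (blockMin ord o) * p (blockMin ord e)) * X (blockMin ord a) * X (blockMin ord b) := by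
  have hne : ¬ ((o = a ∧ e = b) ∨ (o = b ∧ e = a)) :=
    fun h => h0 (quadBinomial_eq_zero ord p h)
  have h1 := C_mul_quadBinomial ord p 1 a b o e
  rw [map_one, one_mul, one_mul, one_mul] at h1
  rw [h1, leadingTerm_binomial (plOrder_pair_lt ord h hne) (mul_ne_zero (hp _) (hp _)), X, X,
    C_mul_monomial, monomial_mul, mul_one, mul_one, pairExponent]

end Binomials

end PolyDiag

theorem theorem3p3 {k : Type*} [Field k] {n d : ℕ} (r : Fin n → ℕ) (hr : ∀ α, 1 ≤ r α)
    (hd : 1 ≤ d) (hdr : d ≤ ∑ α, r α)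
    (ord : ∀ a : Str r d, MonomialOrder.{0, w} (block a)) :
    ∃ m : MonomialOrder.{0, 0} (Pl r d), ExtendsBlockOrders ord m ∧
      ∀ p : Pl r d → k, (∀ u, p u ≠ 0) →
        orbitIdeal p = vanishingIdeal k (orbitCone p) ∧
        IsReducedGroebnerBasis m (groebnerSet ord p) (orbitIdeal p) ∧
        (∀ a, ∀ u ∈ block a, linBinomial ord p a u ≠ 0 →
          m.leadingTerm (linBinomial ord p a u) = C (p (blockMin ord a)) * X u) ∧
        (∀ a b o e, SortsTo a b o e → quadBinomial ord p a b o e ≠ 0 →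
          m.leadingTerm (quadBinomial ord p a b o e) =
            C (p (blockMin ord o) * p (blockMin ord e)) *
              X (blockMin ord a) * X (blockMin ord b)) ∧
        IsReducedGroebnerBasis m (monicGroebnerSet ord p) (orbitIdeal p) ∧
        (∀ g ∈ monicGroebnerSet ord p, m.Monic g) ∧
        (∀ G : Set (MvPolynomial (Pl r d) k), IsReducedGroebnerBasis m G (orbitIdeal p) →
          (∀ g ∈ G, m.Monic g) → G = monicGroebnerSet ord p) := by
  refine ⟨plOrder ord, plOrder_extends ord, fun p hp => ?_⟩
  have hmonic : IsReducedGroebnerBasis (plOrder ord) (monicGroebnerSet ord p) (orbitIdeal p) :=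
    isReducedGroebnerBasis_scaledBinomials ord hd hp (fun a => inv_ne_zero (hp _))
      fun o e => inv_ne_zero (mul_ne_zero (hp _) (hp _))
  refine ⟨orbitIdeal_eq_vanishingIdeal hd p, ?_,
    fun a u hu h0 => leadingTerm_linBinomial ord hp hu h0,
    fun a b o e h h0 => leadingTerm_quadBinomial ord hp h h0, hmonic,
    fun g hg => monic_of_mem_monicGroebnerSet ord hp hg, fun G hG hGm =>
      hG.eq_of_monic hmonic hGm fun g hg => monic_of_mem_monicGroebnerSet ord hp hg⟩
  rw [groebnerSet_eq_scaledBinomials]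
  exact isReducedGroebnerBasis_scaledBinomials ord hd hp (fun _ => one_ne_zero)
    fun _ _ => one_ne_zero
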